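/- Notation. Let $PSH(\mathbb{C}^n)$ be the class of plurisubharmonic functions $u:\mathbb{C}^n\to[-\infty,\infty)$, and let $\gamma_u=\limsup_{\|z\|\to\infty} u(z)/\log\|z\|$. A plurisubharmonic function $u$ on an open set $D\subset\mathbb{C}^n$ is maximal on $D$ if for every open set $G$ that is relatively compact in $D$ and every upper semicontinuous function $v:\overline G\to[-\infty,\infty)$ that is plurisubharmonic on $G$ and satisfies $v\le u$ on $\partial G$, one has $v\le u$ on $G$. For a finite set $S\subset\mathbb{C}^n$ let $E(S)$ be the class of all $u\in PSH(\mathbb{C}^n)$ such that $\gamma_u<+\infty$, $u$ is locally bounded and maximal on $\mathbb{C}^n\setminus S$, $u=-\infty$ on $S$, and $u(z)=\log\|z-p\|+O(1)$ as $z\to p$ for every $p\in S$. Put $\gamma(S)=\inf\{\gamma_u : u\in E(S)\}$, with $\inf\emptyset=+\infty$. Let $m_1(S)$ be the maximum number of points of $S$ contained in a complex line (an algebraic curve of degree one) of $\mathbb{C}^n$. Lemma 2.2. Let $S\subset\mathbb{C}^n$ be a set with $|S|\in\{3,4\}$ and $m_1(S)=2$ (that is, no three points of $S$ lie on a complex line).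 Then $\gamma(S)=2$. -/

import Mathlib

namespace PluriGreen

/-- The space `ℂⁿ` with its Hermitian norm. -/
abbrev Cn (n : ℕ) : Type := EuclideanSpace ℂ (Fin n)

/-- The mean over `[0, 2π]` of a function with values in `[-∞, ∞]`: the mean of the positive part
minus the mean of the negative part.  It is used only for functions that are bounded above, where
the first term is finite. -/
noncomputable def circleMean (g : ℝ → EReal) : EReal :=
  ((MeasureTheory.laverage (MeasureTheory.volume.restrict (Set.Ioc 0 (2 * Real.pi)))
      (fun θ => (g θ).toENNReal) : ENNReal) : EReal) -
    ((MeasureTheory.laverage (MeasureTheory.volume.restrict (Set.Ioc 0 (2 * Real.pi)))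
      (fun θ => (-g θ).toENNReal) : ENNReal) : EReal)

/-- `u` is plurisubharmonic on the open set `D`: it is upper semicontinuous with values in
`[-∞, ∞)`, and it satisfies the sub-mean value inequality on the boundary of every closed affine
complex disc `{a + ζ b : |ζ| ≤ 1}` contained in `D`.  (The function that is constantly `-∞` is
allowed.  Values of `u` outside `D` play no role.) -/
structure IsPSHOn {n : ℕ} (u : Cn n → EReal) (D : Set (Cn n)) : Prop where
  usc : UpperSemicontinuousOn u D
  lt_top : ∀ z ∈ D, u z < ⊤
  submean : ∀ a b : Cn n, (∀ ζ : ℂ, ‖ζ‖ ≤ 1 → a + ζ • b ∈ D) →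
    u a ≤ circleMean (fun θ : ℝ => u (a + circleMap 0 1 θ • b))

/-- `u` is locally bounded on the open set `D`; in particular it is finite there. -/
def IsLocallyBoundedOn {n : ℕ} (u : Cn n → EReal) (D : Set (Cn n)) : Prop :=
  ∀ x ∈ D, ∃ C : ℝ, ∀ᶠ z in nhds x, ((-C : ℝ) : EReal) ≤ u z ∧ u z ≤ (C : EReal)

/-- The plurisubharmonic function `u` is maximal on the open set `D`: for every open `G` relatively
compact in `D` and every `v` which is upper semicontinuous on the closure of `G` and
plurisubharmonic on `G`, `v ≤ u` on `∂G` implies `v ≤ u` on `G`. -/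
def IsMaximalOn {n : ℕ} (u : Cn n → EReal) (D : Set (Cn n)) : Prop :=
  ∀ G : Set (Cn n), IsOpen G → IsCompact (closure G) → closure G ⊆ D →
    ∀ v : Cn n → EReal, UpperSemicontinuousOn v (closure G) → IsPSHOn v G →
      (∀ z ∈ frontier G, v z ≤ u z) → ∀ z ∈ G, v z ≤ u z

/-- `u` has a logarithmic pole of weight `α` at `p`, that is, `u(z) = α log ‖z - p‖ + O(1)` for `z`
near `p`; at `z = p` this says `u(p) = -∞`. -/
def HasLogPole {n : ℕ} (u : Cn n → EReal) (α : ℝ) (p : Cn n) : Prop :=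
  u p = ⊥ ∧ ∃ C : ℝ, ∀ᶠ z in nhdsWithin p {p}ᶜ,
    ((α * Real.log ‖z - p‖ - C : ℝ) : EReal) ≤ u z ∧
      u z ≤ ((α * Real.log ‖z - p‖ + C : ℝ) : EReal)

/-- The growth constant `γ_u`, the upper limit of `u(z) / log ‖z‖` as `‖z‖ → ∞`, in `[-∞, ∞]`. -/
noncomputable def growth {n : ℕ} (u : Cn n → EReal) : EReal :=
  Filter.limsup (fun z : Cn n => u z / ((Real.log ‖z‖ : ℝ) : EReal)) (Bornology.cobounded (Cn n))

/-- `u` is an entire pluricomplex Green function of `S`. -/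
structure IsEntireGreen {n : ℕ} (S : Set (Cn n)) (u : Cn n → EReal) : Prop where
  psh : IsPSHOn u Set.univ
  log_growth : growth u < ⊤
  locally_bounded : IsLocallyBoundedOn u Sᶜ
  maximal : IsMaximalOn u Sᶜ
  eq_bot : ∀ p ∈ S, u p = ⊥

/-- The class `E(S)` of entire pluricomplex Green functions of `S` with logarithmic poles of
weight 1 at all points of `S`. -/
def greenClass {n : ℕ} (S : Set (Cn n)) : Set (Cn n → EReal) :=
  {u | IsEntireGreen S u ∧ ∀ p ∈ S, HasLogPole u 1 p}

/-- The invariant `γ(S)`, the infimum of `γ_u` over `u ∈ E(S)`; it is `+∞` if `E(S)` is empty. -/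
noncomputable def gammaInv {n : ℕ} (S : Set (Cn n)) : EReal :=
  ⨅ u ∈ greenClass S, growth u

/-- `m₁(S)`: the maximum number of points of `S` that are contained in an algebraic curve of degree
one, that is, in a complex (affine) line of `ℂⁿ`. -/
noncomputable def m₁ {n : ℕ} (S : Set (Cn n)) : ℕ∞ :=
  ⨆ (L : AffineSubspace ℂ (Cn n)) (_ : Module.finrank ℂ L.direction = 1),
    (S ∩ (L : Set (Cn n))).encard

end PluriGreen

open MeasureTheory Filter Topology

namespace PluriGreen

variable {n : ℕ}

/-! Upper bound: if a quadratic map `F` from `ℂⁿ` to itself vanishes exactly on `S`, with invertible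
derivative there, then `log ‖F‖` lies in `E(S)` and grows at most like `2 log ‖z‖`. Maximality holds
because at every point off the zeros some direction `b` has `DF b` parallel to `F`; along it `log
‖F‖` is harmonic up to a fourth-order error from above, so a plurisubharmonic competitor cannot
exceed it.

Such an `F` (`gammaInv_le_two_of_linePairs`) intersects two pairs of lines in coordinates `(a, b)`
and puts the intersection points on a graph over that plane. Four coplanar points in general
position are the base points of such a pencil of conics; for three points the fourth intersection
escapes to infinity; four affinely independent points lie on a graph with quadratic term `a b`.

Lower bound (`two_le_growth`): on the line through two poles, `u` is subharmonic with logarithmic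
poles at 0 and 1. If it grew slower than `2 log |ζ|`, subtracting `s (log |ζ| + log |ζ - 1|)` with
suitable `s < 1` would leave a function tending to `-∞` at 0, 1 and infinity, against the maximum
principle. -/

/-! ### Circle means and Jensen's inequality -/

theorem circleMean_mono_ae {g h : ℝ → EReal}
    (hgh : ∀ᵐ θ ∂(volume.restrict (Set.Ioc 0 (2 * Real.pi))), g θ ≤ h θ) :
    circleMean g ≤ circleMean h := by
  have smul_ae : ∀ᵐ θ ∂((volume.restrict (Set.Ioc 0 (2 * Real.pi))) Set.univ)⁻¹ •
      (volume.restrict (Set.Ioc 0 (2 * Real.pi))), g θ ≤ h θ :=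
    Measure.ae_smul_measure hgh _
  refine EReal.sub_le_sub ?_ ?_
  · refine EReal.coe_ennreal_le_coe_ennreal_iff.2 (lintegral_mono_ae ?_)
    filter_upwards [smul_ae] with θ hθ using EReal.toENNReal_le_toENNReal hθ
  · refine EReal.coe_ennreal_le_coe_ennreal_iff.2 (lintegral_mono_ae ?_)
    filter_upwards [smul_ae] with θ hθ using
      EReal.toENNReal_le_toENNReal (EReal.neg_le_neg_iff.2 hθ)

theorem circleMean_mono {g h : ℝ → EReal} (hgh : ∀ θ, g θ ≤ h θ) :
    circleMean g ≤ circleMean h :=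
  circleMean_mono_ae (Eventually.of_forall hgh)

theorem circleMean_coe {f : ℂ → ℝ} {c : ℂ} {R : ℝ} (hf : CircleIntegrable f c R) :
    circleMean (fun θ => ((f (circleMap c R θ) : ℝ) : EReal)) = (Real.circleAverage f c R : ℝ) := by
  have hpi : (0 : ℝ) ≤ 2 * Real.pi := by positivity
  have hint : IntegrableOn (fun θ => f (circleMap c R θ)) (Set.Ioc 0 (2 * Real.pi)) :=
    (intervalIntegrable_iff_integrableOn_Ioc_of_le hpi).1 hf
  set μ := volume.restrict (Set.Ioc 0 (2 * Real.pi)) with hμ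
  have hμ0 : μ Set.univ ≠ 0 := by simp [hμ, Real.pi_pos]
  have hint' : Integrable (fun θ => f (circleMap c R θ)) ((μ Set.univ)⁻¹ • μ) :=
    Integrable.smul_measure hint (ENNReal.inv_ne_top.2 hμ0)
  have hpos : (∫⁻ θ, ENNReal.ofReal (f (circleMap c R θ)) ∂((μ Set.univ)⁻¹ • μ)) ≠ ⊤ :=
    (lt_of_le_of_lt (lintegral_mono fun θ => ENNReal.ofReal_le_ofReal (le_abs_self _))
      (by simpa [HasFiniteIntegral, ← ofReal_norm] using hint'.2)).ne
  have hneg : (∫⁻ θ, ENNReal.ofReal (-f (circleMap c R θ)) ∂((μ Set.univ)⁻¹ • μ)) ≠ ⊤ :=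
    (lt_of_le_of_lt (lintegral_mono fun θ => ENNReal.ofReal_le_ofReal (neg_le_abs _))
      (by simpa [HasFiniteIntegral, ← ofReal_norm] using hint'.2)).ne
  have key := integral_eq_lintegral_pos_part_sub_lintegral_neg_part hint'
  rw [Real.circleAverage_eq_intervalAverage, Set.uIoc_of_le hpi]
  change _ = ((∫ θ, f (circleMap c R θ) ∂((μ Set.univ)⁻¹ • μ) : ℝ) : EReal)
  rw [key, EReal.coe_sub, EReal.coe_ennreal_toReal hpos, EReal.coe_ennreal_toReal hneg]
  rfl

/-- Jensen's inequality, read off from the bound of the constant coefficient by the Mahler measure: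
the binomial factor is 1 there. -/
theorem log_norm_eval_zero_le_circleMean {p : Polynomial ℂ} (hp : p.eval 0 ≠ 0) :
    ((Real.log ‖p.eval 0‖ : ℝ) : EReal) ≤
      circleMean (fun θ => ((Real.log ‖p.eval (circleMap 0 1 θ)‖ : ℝ) : EReal)) := by
  have hint : CircleIntegrable (fun z => Real.log ‖p.eval z‖) 0 1 := p.intervalIntegrable_mahlerMeasure
  rw [circleMean_coe (f := fun z => Real.log ‖p.eval z‖) hint]
  refine EReal.coe_le_coe_iff.2 ?_
  change _ ≤ p.logMahlerMeasure
  rw [Polynomial.logMahlerMeasure_eq_log_MahlerMeasure]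
  refine Real.log_le_log (norm_pos_iff.2 hp) ?_
  have := p.norm_coeff_le_choose_mul_mahlerMeasure 0
  simpa [Polynomial.coeff_zero_eq_eval_zero] using this

theorem ae_eval_circleMap_ne_zero {p : Polynomial ℂ} (hp : p ≠ 0) :
    ∀ᵐ θ : ℝ, p.eval (circleMap 0 1 θ) ≠ 0 := by
  have hc : (circleMap 0 1 ⁻¹' {z | p.eval z = 0}).Countable :=
    Set.Countable.preimage_circleMap
      ((p.roots.toFinset.countable_toSet).mono fun z hz => by simpa [hp] using hz) 0 one_ne_zero
  exact measure_eq_zero_iff_ae_notMem.1 (hc.measure_zero volume)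

/-- A function satisfying the sub-mean value inequality on small circles cannot touch from below,
at the centre, the real part of a holomorphic function minus a quadratic term. -/
theorem not_submean_of_le_re_sub_sq {g : ℂ → EReal} {H : ℂ → ℂ} {ε C : ℝ} (hε : 0 < ε)
    (hH : AnalyticAt ℂ H 0) (h0 : g 0 = ((H 0).re : ℝ))
    (hle : ∀ᶠ ζ in 𝓝 0, g ζ ≤ (((H ζ).re + C * ‖ζ‖ ^ 4 - ε * ‖ζ‖ ^ 2 : ℝ) : EReal))
    (hsub : ∀ᶠ r : ℝ in 𝓝[>] 0, g 0 ≤ circleMean (fun θ => g (circleMap 0 r θ))) : False := by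
  obtain ⟨ρ, hρ, hball⟩ := Metric.eventually_nhds_iff_ball.1 (hle.and hH.eventually_analyticAt)
  have hsmall : ∀ᶠ r : ℝ in 𝓝[>] 0, C * r ^ 2 < ε := by
    have : Tendsto (fun r : ℝ => C * r ^ 2) (𝓝 0) (𝓝 (C * 0 ^ 2)) := by
      exact Continuous.tendsto (by fun_prop) 0
    exact (this.eventually (gt_mem_nhds (by simpa using hε))).filter_mono nhdsWithin_le_nhds
  obtain ⟨r, hr1, hr2, hr3⟩ := (hsub.and (hsmall.and
    (Ioo_mem_nhdsGT hρ))).exists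
  have hr0 : 0 < r := hr3.1
  have hsphere : ∀ ζ ∈ Metric.closedBall (0 : ℂ) r, ζ ∈ Metric.ball (0 : ℂ) ρ := fun ζ hζ =>
    Metric.closedBall_subset_ball hr3.2 hζ
  have hcont : ContinuousOn H (Metric.closedBall 0 r) := fun ζ hζ =>
    (hball ζ (hsphere ζ hζ)).2.continuousAt.continuousWithinAt
  have hci : CircleIntegrable H 0 r :=
    (hcont.mono Metric.sphere_subset_closedBall).circleIntegrable hr0.le
  have hd : DiffContOnCl ℂ H (Metric.ball 0 |r|) := by
    rw [abs_of_pos hr0]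
    refine DifferentiableOn.diffContOnCl fun ζ hζ => ?_
    rw [closure_ball _ hr0.ne'] at hζ
    exact (hball ζ (hsphere ζ hζ)).2.differentiableAt.differentiableWithinAt
  have hmean : Real.circleAverage (fun ζ => (H ζ).re) 0 r = (H 0).re := by
    have h1 := Complex.reCLM.circleAverage_comp_comm hci
    rw [hd.circleAverage] at h1
    exact h1
  -- On the circle of radius `r` the error terms are this constant, negative since `C r² < ε`; the
  -- harmonic part averages to its central value.
  set c := C * r ^ 4 - ε * r ^ 2 with hc
  have hcirc : CircleIntegrable (fun ζ => (H ζ).re + c) 0 r :=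
    ContinuousOn.circleIntegrable hr0.le
      (((Complex.continuous_re.comp_continuousOn hcont).mono
        Metric.sphere_subset_closedBall).add continuousOn_const)
  have hup : circleMean (fun θ => g (circleMap 0 r θ)) ≤ (((H 0).re + c : ℝ) : EReal) := by
    calc circleMean (fun θ => g (circleMap 0 r θ))
        ≤ circleMean (fun θ => (((H (circleMap 0 r θ)).re + c : ℝ) : EReal)) := by
          refine circleMean_mono fun θ => ?_
          have hn : ‖circleMap 0 r θ‖ = r := by simp [abs_of_pos hr0]
          have := (hball (circleMap 0 r θ) (hsphere _ (by simp [abs_of_pos hr0]))).1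
          rw [hn] at this
          rwa [hc, ← add_sub_assoc]
      _ = _ := by
          rw [circleMean_coe (f := fun ζ => (H ζ).re + c) hcirc]
          congr 1
          rw [← hmean]
          have := Real.circleAverage_add (f₁ := fun ζ => (H ζ).re) (f₂ := fun _ => c) (c := 0)
            (R := r) (((Complex.continuous_re.comp_continuousOn hcont).mono
              Metric.sphere_subset_closedBall).circleIntegrable hr0.le)
              (circleIntegrable_const c 0 r)
          rw [Real.circleAverage_const] at this
          exact this
  have hfin := hr1.trans hup
  rw [h0, EReal.coe_le_coe_iff] at hfin
  nlinarith [mul_pos (pow_pos hr0 2) (sub_pos.2 hr2)]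

/-! ### Quadratic maps and plurisubharmonicity of `log ‖F‖` -/

/-- The quadratic polynomial map vanishing at `p` with linear part `L` and quadratic part `B`. -/
noncomputable def quadMap (p : Cn n) (L : Cn n →L[ℂ] Cn n) (B : Cn n →L[ℂ] Cn n →L[ℂ] Cn n)
    (z : Cn n) : Cn n :=
  L (z - p) + B (z - p) (z - p)

/-- The derivative of `quadMap p L B` at `z`. -/
noncomputable def quadDeriv (p : Cn n) (L : Cn n →L[ℂ] Cn n) (B : Cn n →L[ℂ] Cn n →L[ℂ] Cn n)
    (z : Cn n) : Cn n →L[ℂ] Cn n :=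
  L + B (z - p) + B.flip (z - p)

theorem quadMap_add (p : Cn n) (L : Cn n →L[ℂ] Cn n) (B : Cn n →L[ℂ] Cn n →L[ℂ] Cn n)
    (z h : Cn n) :
    quadMap p L B (z + h) = quadMap p L B z + quadDeriv p L B z h + B h h := by
  simp only [quadMap, quadDeriv, add_sub_right_comm, map_add, add_apply,
    ContinuousLinearMap.flip_apply]
  abel

theorem quadMap_add_smul (p : Cn n) (L : Cn n →L[ℂ] Cn n) (B : Cn n →L[ℂ] Cn n →L[ℂ] Cn n)
    (z b : Cn n) (ζ : ℂ) :
    quadMap p L B (z + ζ • b) = quadMap p L B z + ζ • quadDeriv p L B z b + ζ ^ 2 • B b b := by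
  rw [quadMap_add]
  simp [smul_smul, sq]

theorem continuous_quadMap (p : Cn n) (L : Cn n →L[ℂ] Cn n) (B : Cn n →L[ℂ] Cn n →L[ℂ] Cn n) :
    Continuous (quadMap p L B) := by
  unfold quadMap
  fun_prop

/-- The function `log ‖F‖`, equal to `-∞` at the zeros of `F`. -/
noncomputable def logNorm (F : Cn n → Cn n) (z : Cn n) : EReal := ENNReal.log ‖F z‖ₑ

theorem logNorm_of_ne_zero {F : Cn n → Cn n} {z : Cn n} (h : F z ≠ 0) :
    logNorm F z = (Real.log ‖F z‖ : ℝ) := by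
  rw [logNorm, ← ofReal_norm, ENNReal.log_ofReal_of_pos (norm_pos_iff.2 h)]

theorem logNorm_of_eq_zero {F : Cn n → Cn n} {z : Cn n} (h : F z = 0) : logNorm F z = ⊥ := by
  simp [logNorm, h]

theorem continuous_logNorm {F : Cn n → Cn n} (hF : Continuous F) : Continuous (logNorm F) :=
  ENNReal.continuous_log.comp hF.enorm

theorem logNorm_lt_top (F : Cn n → Cn n) (z : Cn n) : logNorm F z < ⊤ := by
  simp [logNorm]

/-- `log ‖F‖` dominates `log |⟨e, F⟩|` for every unit vector `e`, with equality at `a` when `e = F a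
/ ‖F a‖`; on a complex disc `⟨e, F⟩` is a polynomial, so Jensen applies. -/
theorem isPSHOn_logNorm_quadMap (p : Cn n) (L : Cn n →L[ℂ] Cn n)
    (B : Cn n →L[ℂ] Cn n →L[ℂ] Cn n) : IsPSHOn (logNorm (quadMap p L B)) Set.univ where
  usc := (continuous_logNorm (continuous_quadMap p L B)).continuousOn.upperSemicontinuousOn
  lt_top z _ := logNorm_lt_top _ z
  submean a b _ := by
    set F := quadMap p L B with hF
    rcases eq_or_ne (F a) 0 with ha | ha
    · rw [logNorm_of_eq_zero ha]
      exact bot_le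
    have hna : (‖F a‖ : ℂ) ≠ 0 := by simpa using ha
    set e : Cn n := (‖F a‖ : ℂ)⁻¹ • F a with he
    have hen : ‖e‖ = 1 := by
      rw [he, norm_smul]
      simp [norm_ne_zero_iff.2 ha]
    let P : Polynomial ℂ := Polynomial.C (inner ℂ e (F a)) +
      Polynomial.C (inner ℂ e (quadDeriv p L B a b)) * Polynomial.X +
      Polynomial.C (inner ℂ e (B b b)) * Polynomial.X ^ 2
    have hP : ∀ ζ, P.eval ζ = inner ℂ e (F (a + ζ • b)) := fun ζ => by
      rw [hF, quadMap_add_smul]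
      simp only [P, Polynomial.eval_add, Polynomial.eval_mul, Polynomial.eval_C, Polynomial.eval_X,
        Polynomial.eval_pow, inner_add_right, inner_smul_right]
      ring
    have hP0 : P.eval 0 = (‖F a‖ : ℂ) := by
      rw [hP, zero_smul, add_zero, he, inner_smul_left, inner_self_eq_norm_sq_to_K]
      simp only [map_inv₀, Complex.conj_ofReal, Complex.coe_algebraMap]
      field_simp
    have hPne : P.eval 0 ≠ 0 := by rwa [hP0]
    calc logNorm F a = ((Real.log ‖P.eval 0‖ : ℝ) : EReal) := by
          rw [logNorm_of_ne_zero ha, hP0]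
          simp
      _ ≤ circleMean (fun θ => ((Real.log ‖P.eval (circleMap 0 1 θ)‖ : ℝ) : EReal)) :=
          log_norm_eval_zero_le_circleMean hPne
      _ ≤ _ := by
          refine circleMean_mono_ae (ae_restrict_of_ae ?_)
          have hP' : P ≠ 0 := fun h => hPne (by simp [h])
          -- Zeros of `P` must be discarded: there `Real.log` takes the value 0 instead of `-∞`.
          filter_upwards [ae_eval_circleMap_ne_zero hP'] with θ hθ
          have hle : ‖P.eval (circleMap 0 1 θ)‖ ≤ ‖F (a + circleMap 0 1 θ • b)‖ := by
            rw [hP]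
            simpa [hen] using norm_inner_le_norm (𝕜 := ℂ) e (F (a + circleMap 0 1 θ • b))
          have hpos := norm_pos_iff.2 hθ
          rw [logNorm_of_ne_zero (norm_pos_iff.1 (hpos.trans_le hle)), EReal.coe_le_coe_iff]
          exact Real.log_le_log hpos hle

/-! ### Maximality of `log ‖F‖` off its zeros -/

/-- This is `log t ≤ t - 1` at `t = ‖w + h‖² / ‖w‖²`. -/
theorem log_norm_add_le {w h : Cn n} (hw : w ≠ 0) (hwh : w + h ≠ 0) :
    Real.log ‖w + h‖ ≤
      Real.log ‖w‖ + (inner ℂ w h).re / ‖w‖ ^ 2 + ‖h‖ ^ 2 / (2 * ‖w‖ ^ 2) := by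
  have h1 := norm_pos_iff.2 hw
  have h2 := norm_pos_iff.2 hwh
  have h3 := Real.log_le_sub_one_of_pos (x := ‖w + h‖ ^ 2 / ‖w‖ ^ 2) (by positivity)
  rw [Real.log_div (by positivity) (by positivity), Real.log_pow, Real.log_pow,
    norm_add_sq (𝕜 := ℂ)] at h3
  simp only [Nat.cast_ofNat, RCLike.re_to_complex] at h3
  have h4 : (‖w‖ ^ 2 + 2 * (inner ℂ w h).re + ‖h‖ ^ 2) / ‖w‖ ^ 2 - 1 =
      2 * ((inner ℂ w h).re / ‖w‖ ^ 2 + ‖h‖ ^ 2 / (2 * ‖w‖ ^ 2)) := by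
    field_simp
    ring
  linarith

/-- Since the linear term is parallel to `w`, factor out `1 + cζ`. The remaining perturbation of `w`
is `O(ζ²)`: its first-order effect is the real part of a holomorphic function, and its square gives
the `‖ζ‖ ^ 4` error. -/
theorem exists_analytic_log_norm_le {F : ℂ → Cn n} {w g : Cn n} {c : ℂ} (hw : w ≠ 0)
    (hF : ∀ ζ, F ζ = w + ζ • c • w + ζ ^ 2 • g) :
    ∃ (H : ℂ → ℂ) (C : ℝ), AnalyticAt ℂ H 0 ∧ (H 0).re = Real.log ‖w‖ ∧
      ∀ᶠ ζ in 𝓝 0, Real.log ‖F ζ‖ ≤ (H ζ).re + C * ‖ζ‖ ^ 4 := by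
  have hnw := norm_pos_iff.2 hw
  refine ⟨fun ζ => (Real.log ‖w‖ : ℂ) + Complex.log (1 + ζ * c) +
    ζ ^ 2 / (1 + ζ * c) * inner ℂ w g / (‖w‖ ^ 2 : ℝ), 2 * ‖g‖ ^ 2 / ‖w‖ ^ 2, ?_, ?_, ?_⟩
  · have h1 : AnalyticAt ℂ (fun ζ : ℂ => 1 + ζ * c) 0 := by fun_prop
    have h2 : (fun ζ : ℂ => 1 + ζ * c) 0 ≠ 0 := by simp
    refine (analyticAt_const.add (h1.clog (by simp))).add ?_
    exact (((analyticAt_id.pow 2).div h1 h2).mul analyticAt_const).div analyticAt_const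
      (by simpa using hw)
  · simp
  · have hs : ∀ᶠ ζ : ℂ in 𝓝 0, (1 / 2 : ℝ) < ‖1 + ζ * c‖ := by
      have : Tendsto (fun ζ : ℂ => ‖1 + ζ * c‖) (𝓝 0) (𝓝 ‖1 + 0 * c‖) :=
        Continuous.tendsto (by fun_prop) 0
      exact this.eventually (lt_mem_nhds (by norm_num))
    have hne : ∀ᶠ ζ : ℂ in 𝓝 0, F ζ ≠ 0 := by
      have : Tendsto F (𝓝 0) (𝓝 (F 0)) := by
        rw [show F = fun ζ => w + ζ • c • w + ζ ^ 2 • g from funext hF]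
        exact Continuous.tendsto (by fun_prop) 0
      exact this.eventually_ne (by rw [hF]; simpa using hw)
    filter_upwards [hs, hne] with ζ hs hne
    set s := 1 + ζ * c with hsdef
    have hs0 : s ≠ 0 := norm_pos_iff.1 (by linarith)
    have hfac : F ζ = s • (w + (ζ ^ 2 / s) • g) := by
      rw [hF, smul_add, smul_smul s, mul_div_cancel₀ _ hs0, hsdef, add_smul, one_smul, smul_smul]
    have hne' : w + (ζ ^ 2 / s) • g ≠ 0 := fun h => hne (by rw [hfac, h, smul_zero])
    have h1 := log_norm_add_le hw hne'
    rw [hfac, norm_smul, Real.log_mul (norm_ne_zero_iff.2 hs0) (norm_ne_zero_iff.2 hne')]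
    have h2 : ‖(ζ ^ 2 / s) • g‖ ^ 2 / (2 * ‖w‖ ^ 2) ≤ 2 * ‖g‖ ^ 2 / ‖w‖ ^ 2 * ‖ζ‖ ^ 4 := by
      have h3 : ‖ζ ^ 2 / s‖ ≤ 2 * ‖ζ‖ ^ 2 := by
        rw [norm_div, norm_pow, div_le_iff₀ (by linarith)]
        nlinarith [sq_nonneg ‖ζ‖]
      calc ‖(ζ ^ 2 / s) • g‖ ^ 2 / (2 * ‖w‖ ^ 2)
          = ‖ζ ^ 2 / s‖ ^ 2 * ‖g‖ ^ 2 / (2 * ‖w‖ ^ 2) := by rw [norm_smul, mul_pow]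
        _ ≤ (2 * ‖ζ‖ ^ 2) ^ 2 * ‖g‖ ^ 2 / (2 * ‖w‖ ^ 2) := by gcongr
        _ = _ := by ring
    have h4 : (ζ ^ 2 / s * inner ℂ w g / (‖w‖ ^ 2 : ℝ)).re =
        (inner ℂ w ((ζ ^ 2 / s) • g)).re / ‖w‖ ^ 2 := by
      rw [inner_smul_right, Complex.div_ofReal_re]
    simp only [Complex.add_re, Complex.ofReal_re, Complex.log_re, h4]
    linarith

theorem IsPSHOn.eventually_le_circleMean {u : Cn n → EReal} {D : Set (Cn n)} (hu : IsPSHOn u D)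
    (hD : IsOpen D) {a : Cn n} (ha : a ∈ D) (b : Cn n) :
    ∀ᶠ r : ℝ in 𝓝[>] 0, u a ≤ circleMean (fun θ => u (a + circleMap 0 r θ • b)) := by
  have hcont : Tendsto (fun ζ : ℂ => a + ζ • b) (𝓝 0) (𝓝 a) := by
    have : Continuous (fun ζ : ℂ => a + ζ • b) := by fun_prop
    simpa using this.tendsto 0
  obtain ⟨ρ, hρ, hball⟩ := Metric.eventually_nhds_iff_ball.1
    (hcont.eventually (hD.mem_nhds ha))
  filter_upwards [Ioo_mem_nhdsGT hρ] with r hr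
  have h := hu.submean a ((r : ℂ) • b) fun ζ hζ => by
    rw [smul_smul]
    refine hball _ ?_
    rw [mem_ball_zero_iff, norm_mul, Complex.norm_real, Real.norm_of_nonneg hr.1.le]
    nlinarith [hr.1, hr.2]
  have heq : ∀ θ : ℝ, circleMap 0 1 θ • (r : ℂ) • b = circleMap 0 r θ • b := fun θ => by
    rw [smul_smul]
    congr 1
    simp [circleMap, mul_comm]
  simpa only [heq] using h

/-- Either `D` is onto and `w` has a preimage, or `D` has a nonzero kernel vector and `c = 0` works.
-/
theorem exists_ne_zero_map_eq_smul (D : Cn n →L[ℂ] Cn n) (w : Cn n) (hw : w ≠ 0) :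
    ∃ (b : Cn n) (c : ℂ), b ≠ 0 ∧ D b = c • w := by
  by_cases hinj : Function.Injective (D : Cn n →ₗ[ℂ] Cn n)
  · obtain ⟨b, hb⟩ := (LinearMap.injective_iff_surjective.1 hinj) w
    refine ⟨b, 1, ?_, by simpa using hb⟩
    rintro rfl
    exact hw (by simpa using hb.symm)
  · rw [injective_iff_map_eq_zero] at hinj
    push Not at hinj
    obtain ⟨b, hb, hb0⟩ := hinj
    exact ⟨b, 0, hb0, by simpa using hb⟩

theorem norm_add_smul_sq (z b : Cn n) (ζ : ℂ) :
    ‖z + ζ • b‖ ^ 2 = ‖z‖ ^ 2 + 2 * (ζ * inner ℂ z b).re + ‖ζ‖ ^ 2 * ‖b‖ ^ 2 := by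
  rw [norm_add_sq (𝕜 := ℂ), inner_smul_right, norm_smul, mul_pow]
  rfl

theorem isMaximalOn_logNorm_quadMap (p : Cn n) (L : Cn n →L[ℂ] Cn n)
    (B : Cn n →L[ℂ] Cn n →L[ℂ] Cn n) {D : Set (Cn n)} (hD : ∀ z ∈ D, quadMap p L B z ≠ 0) :
    IsMaximalOn (logNorm (quadMap p L B)) D := by
  intro G hG hcomp hGD v hvusc hv hfront z₁ hz₁
  set F := quadMap p L B with hF
  have hFG : ∀ z ∈ closure G, F z ≠ 0 := fun z hz => hD z (hGD hz)
  have hU : ∀ z ∈ closure G, logNorm F z = (Real.log ‖F z‖ : ℝ) := fun z hz =>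
    logNorm_of_ne_zero (hFG z hz)
  by_contra! hlt
  have hz₁' : z₁ ∈ closure G := subset_closure hz₁
  rw [hU z₁ hz₁'] at hlt
  lift v z₁ to ℝ using ⟨(hv.lt_top z₁ hz₁).ne, (bot_le.trans_lt hlt).ne'⟩ with v₁ hv₁
  rw [EReal.coe_lt_coe_iff] at hlt
  obtain ⟨R, hR⟩ := hcomp.isBounded.exists_norm_le
  have hR0 : 0 ≤ R := (norm_nonneg _).trans (hR z₁ hz₁')
  set δ := v₁ - Real.log ‖F z₁‖ with hδ
  have hδ0 : 0 < δ := sub_pos.2 hlt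
  -- Small enough that adding `ε ‖z‖²` cannot move the maximum of `v - log ‖F‖` to the frontier.
  set ε := δ / (R ^ 2 + 1) with hε
  have hε0 : 0 < ε := by positivity
  have hεR : ∀ z ∈ closure G, ε * ‖z‖ ^ 2 < δ := fun z hz => by
    have : ‖z‖ ^ 2 < R ^ 2 + 1 := by nlinarith [hR z hz, norm_nonneg z]
    calc ε * ‖z‖ ^ 2 < ε * (R ^ 2 + 1) := by gcongr
      _ = δ := by rw [hε]; field_simp
  set ψ : Cn n → ℝ := fun z => ε * ‖z‖ ^ 2 - Real.log ‖F z‖ with hψ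
  have hψcont : ContinuousOn ψ (closure G) := by
    refine ContinuousOn.sub (by fun_prop) ?_
    exact ((continuous_quadMap p L B).norm.continuousOn).log
      fun z hz => norm_ne_zero_iff.2 (hFG z hz)
  have husc : UpperSemicontinuousOn (fun z => v z + (ψ z : ℝ)) (closure G) :=
    hvusc.add' (continuous_coe_real_ereal.comp_continuousOn hψcont).upperSemicontinuousOn
      fun z hz => EReal.continuousAt_add (.inr (EReal.coe_ne_bot _)) (.inr (EReal.coe_ne_top _))
  obtain ⟨z₀, hz₀, hmax⟩ := husc.exists_isMaxOn ⟨z₁, hz₁'⟩ hcomp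
  have hmax' : ∀ z ∈ closure G, v z + (ψ z : ℝ) ≤ v z₀ + (ψ z₀ : ℝ) := hmax
  have hge : (δ : EReal) ≤ v z₀ + (ψ z₀ : ℝ) := by
    refine le_trans ?_ (hmax' z₁ hz₁')
    rw [← hv₁, ← EReal.coe_add, EReal.coe_le_coe_iff, hψ, hδ]
    have : 0 ≤ ε * ‖z₁‖ ^ 2 := by positivity
    simp only
    linarith
  have hz₀G : z₀ ∈ G := by
    by_contra hnot
    have hfr : z₀ ∈ frontier G := ⟨hz₀, by rwa [hG.interior_eq]⟩
    have h1 := hfront z₀ hfr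
    rw [hU z₀ hz₀] at h1
    have h2 := hge.trans (add_le_add_left h1 _)
    rw [← EReal.coe_add, EReal.coe_le_coe_iff, hψ] at h2
    have := hεR z₀ hz₀
    simp only at h2
    linarith
  have hbot : v z₀ ≠ ⊥ := fun h => by
    rw [h, EReal.bot_add] at hge
    exact (EReal.bot_lt_coe δ).not_ge hge
  obtain ⟨v₀, hv₀⟩ : ∃ x : ℝ, v z₀ = x :=
    ⟨_, (EReal.coe_toReal (hv.lt_top z₀ hz₀G).ne hbot).symm⟩
  obtain ⟨b, c, hb, hbc⟩ := exists_ne_zero_map_eq_smul (quadDeriv p L B z₀) (F z₀) (hFG z₀ hz₀)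
  obtain ⟨H, C, hHan, hH0, hHle⟩ := exists_analytic_log_norm_le (F := fun ζ => F (z₀ + ζ • b))
    (g := B b b) (c := c) (hFG z₀ hz₀) (fun ζ => by rw [hF, quadMap_add_smul, hbc])
  have hnear : ∀ᶠ ζ : ℂ in 𝓝 0, z₀ + ζ • b ∈ G := by
    have : Continuous (fun ζ : ℂ => z₀ + ζ • b) := by fun_prop
    exact this.continuousAt.eventually (hG.mem_nhds (by simpa using hz₀G))
  refine not_submean_of_le_re_sub_sq (g := fun ζ => v (z₀ + ζ • b))
    -- Maximality at `z₀` bounds `v` by `log ‖F‖ - ε ‖z‖²` plus a constant; the terms of `‖z₀ + ζ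
    -- b‖²` linear in `ζ` go into `H`, leaving `-ε ‖b‖² ‖ζ‖²`.
    (H := fun ζ => ((v₀ + ψ z₀ - ε * ‖z₀‖ ^ 2 : ℝ) : ℂ) + H ζ - (2 * ε : ℝ) * (ζ * inner ℂ z₀ b))
    (ε := ε * ‖b‖ ^ 2) (C := C) (by have := norm_pos_iff.2 hb; positivity) ?_ ?_ ?_ ?_
  · exact (analyticAt_const.add hHan).sub (by fun_prop)
  · simp only [zero_smul, add_zero, zero_mul, mul_zero, sub_zero, Complex.add_re,
      Complex.ofReal_re, hH0, hψ, hv₀]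
    congr 1
    ring
  · filter_upwards [hHle, hnear] with ζ h1 h2
    have h3 := hmax' _ (subset_closure h2)
    rw [hv₀, ← EReal.coe_add] at h3
    have h4 := EReal.le_sub_iff_add_le (.inl (EReal.coe_ne_bot (ψ (z₀ + ζ • b))))
      (.inl (EReal.coe_ne_top _)) |>.2 h3
    refine h4.trans ?_
    rw [← EReal.coe_sub, EReal.coe_le_coe_iff, hψ]
    simp only [norm_add_smul_sq, Complex.sub_re, Complex.add_re, Complex.ofReal_re,
      Complex.re_ofReal_mul]
    linarith
  · simpa using hv.eventually_le_circleMean hG hz₀G b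

/-! ### Poles and growth of `log ‖F‖` -/

theorem hasLogPole_logNorm_quadMap {p : Cn n} {L : Cn n →L[ℂ] Cn n}
    {B : Cn n →L[ℂ] Cn n →L[ℂ] Cn n} {q : Cn n} (hq : quadMap p L B q = 0)
    (hinj : ∀ h, quadDeriv p L B q h = 0 → h = 0) :
    HasLogPole (logNorm (quadMap p L B)) 1 q := by
  refine ⟨logNorm_of_eq_zero hq, ?_⟩
  set D := quadDeriv p L B q with hD
  obtain ⟨K, hK, hKD⟩ := LinearMap.exists_antilipschitzWith (D : Cn n →ₗ[ℂ] Cn n)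
    ((LinearMap.ker_eq_bot').2 hinj)
  have hK0 : (0 : ℝ) < K := hK
  have hlow : ∀ h, ‖h‖ ≤ K * ‖D h‖ := fun h => by
    simpa using hKD.le_mul_norm_sub h 0
  set M := ‖D‖ + ‖B‖ + 1 with hM
  have hM0 : 0 < M := by positivity
  -- So close to `q`, the quadratic term is at most half the lower bound for the linear term.
  have hnear : ∀ᶠ z in 𝓝[≠] q, ‖z - q‖ < 1 ∧ K * ‖B‖ * ‖z - q‖ < 1 / 2 := by
    refine Eventually.filter_mono nhdsWithin_le_nhds ?_
    have h1 : ContinuousAt (fun z : Cn n => ‖z - q‖) q := by fun_prop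
    have h2 : ContinuousAt (fun z : Cn n => K * ‖B‖ * ‖z - q‖) q := by fun_prop
    exact (h1.eventually (gt_mem_nhds (by simp))).and (h2.eventually (gt_mem_nhds (by simp)))
  refine ⟨max (Real.log (2 * K)) (Real.log M), ?_⟩
  filter_upwards [hnear, self_mem_nhdsWithin] with z ⟨h1, h2⟩ hz
  have hzq : 0 < ‖z - q‖ := norm_pos_iff.2 (sub_ne_zero.2 hz)
  have hexp : quadMap p L B z = D (z - q) + B (z - q) (z - q) := by
    have := quadMap_add p L B q (z - q)
    rwa [add_sub_cancel, hq, zero_add] at this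
  have hB := B.le_opNorm₂ (z - q) (z - q)
  have hD' := D.le_opNorm (z - q)
  have hl := hlow (z - q)
  have hlower : ‖z - q‖ / (2 * K) ≤ ‖quadMap p L B z‖ := by
    have h3 := norm_sub_le_norm_add (D (z - q)) (B (z - q) (z - q))
    rw [← hexp] at h3
    rw [div_le_iff₀ (by positivity)]
    have h4 : K * ‖B (z - q) (z - q)‖ ≤ 1 / 2 * ‖z - q‖ := by
      calc K * ‖B (z - q) (z - q)‖ ≤ K * (‖B‖ * ‖z - q‖ * ‖z - q‖) := by gcongr
        _ = K * ‖B‖ * ‖z - q‖ * ‖z - q‖ := by ring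
        _ ≤ 1 / 2 * ‖z - q‖ := by gcongr
    nlinarith
  have hupper : ‖quadMap p L B z‖ ≤ M * ‖z - q‖ := by
    have h3 := norm_add_le (D (z - q)) (B (z - q) (z - q))
    rw [← hexp] at h3
    have h4 : ‖B‖ * ‖z - q‖ * ‖z - q‖ ≤ ‖B‖ * 1 * ‖z - q‖ := by gcongr
    rw [hM]
    nlinarith
  have hpos : 0 < ‖quadMap p L B z‖ := lt_of_lt_of_le (by positivity) hlower
  rw [logNorm_of_ne_zero (norm_pos_iff.1 hpos), EReal.coe_le_coe_iff, EReal.coe_le_coe_iff, one_mul]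
  have h5 := Real.log_le_log (by positivity) hlower
  have h6 := Real.log_le_log hpos hupper
  rw [Real.log_div hzq.ne' (by positivity)] at h5
  rw [Real.log_mul hM0.ne' hzq.ne'] at h6
  constructor
  · linarith [le_max_left (Real.log (2 * K)) (Real.log M)]
  · linarith [le_max_right (Real.log (2 * K)) (Real.log M)]

theorem growth_logNorm_quadMap_le (p : Cn n) (L : Cn n →L[ℂ] Cn n)
    (B : Cn n →L[ℂ] Cn n →L[ℂ] Cn n) : growth (logNorm (quadMap p L B)) ≤ 2 := by
  refine EReal.le_of_forall_lt_iff_le.1 fun a ha => limsup_le_of_le (by isBoundedDefault) ?_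
  have ha2 : (2 : ℝ) < a := EReal.coe_lt_coe_iff.1 ha
  -- From `‖z - p‖ ≤ 2 ‖z‖` and `1 ≤ ‖z‖`; the extra 1 keeps `M` positive.
  set M := 2 * ‖L‖ + 4 * ‖B‖ + 1 with hM
  have hM0 : 0 < M := by positivity
  have hlog : Tendsto (fun z : Cn n => Real.log ‖z‖) (Bornology.cobounded (Cn n)) atTop :=
    Real.tendsto_log_atTop.comp tendsto_norm_cobounded_atTop
  filter_upwards [hlog.eventually_ge_atTop (Real.log M / (a - 2)), hlog.eventually_gt_atTop 0,
    tendsto_norm_cobounded_atTop.eventually_ge_atTop ‖p‖,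
    tendsto_norm_cobounded_atTop.eventually_ge_atTop 1] with z h1 h2 h3 h4
  rcases eq_or_ne (quadMap p L B z) 0 with h0 | h0
  · rw [logNorm_of_eq_zero h0, EReal.bot_div_of_pos_ne_top (by exact_mod_cast h2)
      (EReal.coe_ne_top _)]
    exact bot_le
  rw [logNorm_of_ne_zero h0, ← EReal.coe_div, EReal.coe_le_coe_iff, div_le_iff₀ h2]
  have h5 : ‖z - p‖ ≤ 2 * ‖z‖ := (norm_sub_le z p).trans (by linarith)
  have h6 : ‖quadMap p L B z‖ ≤ M * ‖z‖ ^ 2 := by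
    calc ‖quadMap p L B z‖ ≤ ‖L (z - p)‖ + ‖B (z - p) (z - p)‖ := norm_add_le _ _
      _ ≤ ‖L‖ * ‖z - p‖ + ‖B‖ * ‖z - p‖ * ‖z - p‖ :=
          add_le_add (L.le_opNorm _) (B.le_opNorm₂ _ _)
      _ ≤ ‖L‖ * (2 * ‖z‖) + ‖B‖ * (2 * ‖z‖) * (2 * ‖z‖) := by gcongr
      _ ≤ M * ‖z‖ ^ 2 := by
          rw [hM]
          nlinarith [mul_nonneg (norm_nonneg L) (mul_nonneg (sub_nonneg.2 h4) (norm_nonneg z)),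
            sq_nonneg ‖z‖]
  have h7 := Real.log_le_log (norm_pos_iff.2 h0) h6
  rw [Real.log_mul hM0.ne' (by positivity), Real.log_pow] at h7
  rw [div_le_iff₀ (by linarith)] at h1
  push_cast at h7
  nlinarith

theorem isLocallyBoundedOn_logNorm {F : Cn n → Cn n} (hF : Continuous F) {D : Set (Cn n)}
    (hD : ∀ z ∈ D, F z ≠ 0) : IsLocallyBoundedOn (logNorm F) D := by
  intro x hx
  have hc : ContinuousAt (fun z => Real.log ‖F z‖) x :=
    hF.norm.continuousAt.log (norm_ne_zero_iff.2 (hD x hx))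
  refine ⟨|Real.log ‖F x‖| + 1, ?_⟩
  filter_upwards [hF.continuousAt.eventually_ne (hD x hx), Metric.tendsto_nhds.1 hc 1 one_pos]
    with z h1 h2
  rw [logNorm_of_ne_zero h1, EReal.coe_le_coe_iff, EReal.coe_le_coe_iff]
  rw [Real.dist_eq, abs_lt] at h2
  constructor
  · linarith [neg_abs_le (Real.log ‖F x‖)]
  · linarith [le_abs_self (Real.log ‖F x‖)]

/-- A quadratic map whose zeros are exactly the points of `S`, all of them nondegenerate, yields
a Green function of `S` with growth constant at most two. -/
theorem gammaInv_le_two_of_quadMap {S : Set (Cn n)} {p : Cn n} {L : Cn n →L[ℂ] Cn n}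
    {B : Cn n →L[ℂ] Cn n →L[ℂ] Cn n} (hzero : ∀ z, quadMap p L B z = 0 ↔ z ∈ S)
    (hinj : ∀ q ∈ S, ∀ h, quadDeriv p L B q h = 0 → h = 0) : gammaInv S ≤ 2 := by
  have hne : ∀ z ∈ Sᶜ, quadMap p L B z ≠ 0 := fun z hz h => hz ((hzero z).1 h)
  have hgrowth := growth_logNorm_quadMap_le p L B
  refine iInf₂_le_of_le (logNorm (quadMap p L B)) ⟨⟨isPSHOn_logNorm_quadMap p L B, ?_, ?_, ?_, ?_⟩,
    ?_⟩ hgrowth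
  · exact hgrowth.trans_lt (EReal.coe_lt_top 2)
  · exact isLocallyBoundedOn_logNorm (continuous_quadMap p L B) hne
  · exact isMaximalOn_logNorm_quadMap p L B hne
  · exact fun q hq => logNorm_of_eq_zero ((hzero q).2 hq)
  · exact fun q hq => hasLogPole_logNorm_quadMap ((hzero q).2 hq) (hinj q hq)

/-! ### Lower bound: restriction to a line through two poles -/

/-- The difference of the two sides is at most `(1 - s) log |ζ - c| + O(1)`, which tends to `-∞`. -/
theorem HasLogPole.eventually_lt_add_log {u : Cn n → EReal} {p : Cn n} (hp : HasLogPole u 1 p)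
    {b : Cn n} (hb : b ≠ 0) {c d : ℂ} (hcd : c ≠ d) {s : ℝ} (hs : s < 1) (m : ℝ) :
    ∀ᶠ ζ in 𝓝[≠] c, u (p + (ζ - c) • b) <
      ((m + s * (Real.log ‖ζ - c‖ + Real.log ‖ζ - d‖) : ℝ) : EReal) := by
  obtain ⟨-, C, hC⟩ := hp
  have hline : Tendsto (fun ζ : ℂ => p + (ζ - c) • b) (𝓝[≠] c) (𝓝[≠] p) := by
    refine tendsto_nhdsWithin_iff.2 ⟨?_, ?_⟩
    · have : Continuous (fun ζ : ℂ => p + (ζ - c) • b) := by fun_prop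
      simpa using (this.tendsto c).mono_left nhdsWithin_le_nhds
    · filter_upwards [self_mem_nhdsWithin] with ζ hζ
      simpa [hb, sub_eq_zero] using hζ
  have hlog : Tendsto (fun ζ : ℂ => Real.log ‖ζ - c‖) (𝓝[≠] c) atBot :=
    Real.tendsto_log_nhdsGT_zero.comp (tendsto_norm_sub_self_nhdsNE c)
  have hlogd : Tendsto (fun ζ : ℂ => Real.log ‖b‖ + C - s * Real.log ‖ζ - d‖) (𝓝[≠] c)
      (𝓝 (Real.log ‖b‖ + C - s * Real.log ‖c - d‖)) := by
    have : ContinuousAt (fun ζ : ℂ => Real.log ‖ζ - d‖) c :=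
      ContinuousAt.log (by fun_prop) (norm_ne_zero_iff.2 (sub_ne_zero.2 hcd))
    exact (tendsto_const_nhds.sub (this.tendsto.const_mul s)).mono_left nhdsWithin_le_nhds
  have hbot := (hlog.const_mul_atBot (sub_pos.2 hs)).atBot_add hlogd
  filter_upwards [hline.eventually hC, hbot.eventually_lt_atBot m, self_mem_nhdsWithin]
    with ζ h1 h2 h3
  refine h1.2.trans_lt (EReal.coe_lt_coe_iff.2 ?_)
  have h4 : ‖ζ - c‖ ≠ 0 := norm_ne_zero_iff.2 (sub_ne_zero.2 h3)
  rw [add_sub_cancel_left, norm_smul, Real.log_mul h4 (norm_ne_zero_iff.2 hb)]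
  linarith

theorem tendsto_add_smul_cobounded (p : Cn n) {b : Cn n} (hb : b ≠ 0) :
    Tendsto (fun ζ : ℂ => p + ζ • b) (Bornology.cobounded ℂ) (Bornology.cobounded (Cn n)) := by
  rw [← tendsto_norm_atTop_iff_cobounded]
  have h : Tendsto (fun ζ : ℂ => ‖ζ‖ * ‖b‖ + -‖p‖) (Bornology.cobounded ℂ) atTop :=
    tendsto_atTop_add_const_right _ _
      (tendsto_norm_cobounded_atTop.atTop_mul_const (norm_pos_iff.2 hb))
  refine tendsto_atTop_mono (fun ζ => ?_) h
  have := norm_sub_le_norm_add (ζ • b) p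
  rw [norm_smul, add_comm] at this
  linarith

/-- At infinity the comparison function grows like `2s log |ζ|`, outpacing `a log |ζ|`. -/
theorem eventually_lt_add_log_of_growth_lt {u : Cn n → EReal} {a s : ℝ} (ha : 0 < a)
    (hu : growth u < a) (has : a < 2 * s) (p : Cn n) {b : Cn n} (hb : b ≠ 0) (m : ℝ) :
    ∀ᶠ ζ in Bornology.cobounded ℂ, u (p + ζ • b) <
      ((m + s * (Real.log ‖ζ‖ + Real.log ‖ζ - 1‖) : ℝ) : EReal) := by
  have hlog : Tendsto (fun z : Cn n => Real.log ‖z‖) (Bornology.cobounded (Cn n)) atTop :=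
    Real.tendsto_log_atTop.comp tendsto_norm_cobounded_atTop
  have hlogC : Tendsto (fun z : ℂ => Real.log ‖z‖) (Bornology.cobounded ℂ) atTop :=
    Real.tendsto_log_atTop.comp tendsto_norm_cobounded_atTop
  have hline := tendsto_add_smul_cobounded p hb
  set N := ‖p‖ + ‖b‖ with hN
  have hN0 : 0 < N := by have := norm_pos_iff.2 hb; positivity
  filter_upwards [hline.eventually (eventually_lt_of_limsup_lt hu),
    hline.eventually (hlog.eventually_gt_atTop 0),
    tendsto_norm_cobounded_atTop.eventually_ge_atTop 2,
    hlogC.eventually_gt_atTop ((a * Real.log N + s * Real.log 2 - m) / (2 * s - a))]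
    with ζ h1 h2 h3 h4
  have h5 := (EReal.div_le_iff_le_mul (EReal.coe_pos.2 h2) (EReal.coe_ne_top _)).1 h1.le
  rw [← EReal.coe_mul] at h5
  refine h5.trans_lt (EReal.coe_lt_coe_iff.2 ?_)
  have hζ : 0 < ‖ζ‖ := by linarith
  have hz0 : 0 < ‖p + ζ • b‖ := (norm_nonneg _).lt_of_ne fun h => by
    rw [← h] at h2
    simp at h2
  have h6 : ‖p + ζ • b‖ ≤ N * ‖ζ‖ := by
    refine (norm_add_le _ _).trans ?_
    rw [norm_smul, hN]
    nlinarith [norm_nonneg p]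
  have h7 := Real.log_le_log hz0 h6
  rw [Real.log_mul hN0.ne' hζ.ne'] at h7
  have h8 : ‖ζ‖ / 2 ≤ ‖ζ - 1‖ := by
    have := norm_sub_norm_le ζ 1
    rw [norm_one] at this
    linarith
  have h9 := Real.log_le_log (by positivity) h8
  rw [Real.log_div hζ.ne' two_ne_zero] at h9
  rw [div_lt_iff₀ (by linarith)] at h4
  have hs : 0 < s := by linarith
  nlinarith

theorem exists_analytic_re_eq_log_norm {z : ℂ} (hz : z ≠ 0) :
    ∃ H : ℂ → ℂ, AnalyticAt ℂ H 0 ∧ (H 0).re = Real.log ‖z‖ ∧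
      ∀ᶠ ζ in 𝓝 0, (H ζ).re = Real.log ‖z + ζ‖ := by
  refine ⟨fun ζ => (Real.log ‖z‖ : ℂ) + Complex.log (1 + ζ / z), ?_, by simp, ?_⟩
  · have h1 : AnalyticAt ℂ (fun ζ : ℂ => 1 + ζ / z) 0 := by fun_prop
    exact analyticAt_const.add (h1.clog (by simp))
  · have h : ∀ᶠ ζ : ℂ in 𝓝 0, 1 + ζ / z ≠ 0 := by
      have : ContinuousAt (fun ζ : ℂ => 1 + ζ / z) 0 := by fun_prop
      exact this.eventually_ne (by simp)
    filter_upwards [h] with ζ hζ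
    rw [Complex.add_re, Complex.ofReal_re, Complex.log_re,
      ← Real.log_mul (norm_ne_zero_iff.2 hz) (norm_ne_zero_iff.2 hζ), ← norm_mul]
    congr 2
    field_simp

/-- Restricting to the line through two logarithmic poles shows that the growth constant is
at least two. -/
theorem two_le_growth {u : Cn n → EReal} (hu : IsPSHOn u Set.univ) {p q : Cn n} (hpq : p ≠ q)
    (hp : HasLogPole u 1 p) (hq : HasLogPole u 1 q) : 2 ≤ growth u := by
  by_contra! hlt
  obtain ⟨a', ha1, ha2⟩ := EReal.lt_iff_exists_real_btwn.1 hlt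
  obtain ⟨a, ha, ha0, ha2⟩ : ∃ a : ℝ, growth u < a ∧ 0 < a ∧ a < 2 := by
    refine ⟨max a' 1, ha1.trans_le (EReal.coe_le_coe_iff.2 (le_max_left _ _)), by positivity, ?_⟩
    exact max_lt (EReal.coe_lt_coe_iff.1 ha2) one_lt_two
  -- The midpoint of `a / 2` and 1: `s < 1` controls the poles, `a < 2 s` controls infinity.
  set s := (a / 2 + 1) / 2 with hs
  set b := q - p with hb
  have hb0 : b ≠ 0 := sub_ne_zero.2 hpq.symm
  set g : ℂ → EReal := fun ζ => u (p + ζ • b) with hg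
  set ℓ : ℂ → ℝ := fun ζ => s * (Real.log ‖ζ‖ + Real.log ‖ζ - 1‖) with hℓ
  have near0 : ∀ m : ℝ, ∀ᶠ ζ in 𝓝[≠] 0, g ζ < ((m + ℓ ζ : ℝ) : EReal) := fun m => by
    simpa only [sub_zero] using
      hp.eventually_lt_add_log hb0 (zero_ne_one (α := ℂ)) (s := s) (by linarith) m
  have near1 : ∀ m : ℝ, ∀ᶠ ζ in 𝓝[≠] 1, g ζ < ((m + ℓ ζ : ℝ) : EReal) := fun m => by
    filter_upwards [hq.eventually_lt_add_log hb0 (one_ne_zero (α := ℂ)) (s := s) (by linarith) m]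
      with ζ hζ
    have : q + (ζ - 1) • b = p + ζ • b := by rw [hb, sub_smul, one_smul]; abel
    rwa [this, sub_zero, add_comm (Real.log ‖ζ - 1‖)] at hζ
  have nearInf : ∀ m : ℝ, ∀ᶠ ζ in Bornology.cobounded ℂ, g ζ < ((m + ℓ ζ : ℝ) : EReal) :=
    fun m => eventually_lt_add_log_of_growth_lt ha0 ha (by linarith) p hb0 m
  obtain ⟨ζ₁, m, hζ₁0, hζ₁1, hm⟩ : ∃ (ζ : ℂ) (m : ℝ), ζ ≠ 0 ∧ ζ ≠ 1 ∧
      ((m + ℓ ζ : ℝ) : EReal) ≤ g ζ := by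
    obtain ⟨-, C, hC⟩ := hp
    have hline : Tendsto (fun ζ : ℂ => p + ζ • b) (𝓝[≠] 0) (𝓝[≠] p) := by
      refine tendsto_nhdsWithin_iff.2 ⟨?_, ?_⟩
      · have : Continuous (fun ζ : ℂ => p + ζ • b) := by fun_prop
        simpa using (this.tendsto 0).mono_left nhdsWithin_le_nhds
      · filter_upwards [self_mem_nhdsWithin] with ζ hζ
        simpa [hb0] using hζ
    have hne1 : ∀ᶠ ζ : ℂ in 𝓝[≠] 0, ζ ≠ 1 :=
      (eventually_ne_nhds zero_ne_one).filter_mono nhdsWithin_le_nhds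
    obtain ⟨ζ, h1, h2, h3⟩ := ((hline.eventually hC).and
      (hne1.and self_mem_nhdsWithin)).exists
    refine ⟨ζ, 1 * Real.log ‖p + ζ • b - p‖ - C - ℓ ζ, h3, h2, ?_⟩
    rw [sub_add_cancel]
    exact h1.1
  obtain ⟨ρ₀, hρ₀, h0⟩ :=
    (nhdsWithin_hasBasis Metric.nhds_basis_closedBall _).eventually_iff.1 (near0 (m - 1))
  obtain ⟨ρ₁, hρ₁, h1⟩ :=
    (nhdsWithin_hasBasis Metric.nhds_basis_closedBall _).eventually_iff.1 (near1 (m - 1))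
  obtain ⟨R, hR⟩ : ∃ R : ℝ, ∀ ζ, R ≤ ‖ζ‖ → g ζ < ((m - 1 + ℓ ζ : ℝ) : EReal) := by
    have h := nearInf (m - 1)
    rw [← comap_norm_atTop, eventually_comap] at h
    obtain ⟨R, hR⟩ := eventually_atTop.1 h
    exact ⟨R, fun ζ hζ => hR _ hζ ζ rfl⟩
  set K : Set ℂ := Metric.closedBall 0 R \ (Metric.ball 0 ρ₀ ∪ Metric.ball 1 ρ₁) with hK
  have hKc : IsCompact K :=
    (isCompact_closedBall 0 R).diff (Metric.isOpen_ball.union Metric.isOpen_ball)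
  have hK0 : ∀ ζ ∈ K, ζ ≠ 0 := by
    rintro ζ hζ rfl
    exact hζ.2 (.inl (Metric.mem_ball_self hρ₀))
  have hK1 : ∀ ζ ∈ K, ζ ≠ 1 := by
    rintro ζ hζ rfl
    exact hζ.2 (.inr (Metric.mem_ball_self hρ₁))
  -- The estimates hold on closed discs while `K` omits only open ones, so a point violating them is
  -- interior to `K`.
  have hKnhds : ∀ ζ, ζ ≠ 0 → ζ ≠ 1 → ((m - 1 + ℓ ζ : ℝ) : EReal) ≤ g ζ → K ∈ 𝓝 ζ := by
    intro ζ hζ0 hζ1 hζ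
    have a0 : ζ ∈ (Metric.closedBall (0 : ℂ) ρ₀)ᶜ := fun h => (h0 ⟨h, hζ0⟩).not_ge hζ
    have a1 : ζ ∈ (Metric.closedBall (1 : ℂ) ρ₁)ᶜ := fun h => (h1 ⟨h, hζ1⟩).not_ge hζ
    have aR : ζ ∈ Metric.ball (0 : ℂ) R := by
      by_contra h
      exact (hR ζ (by simpa using h)).not_ge hζ
    filter_upwards [Metric.isClosed_closedBall.isOpen_compl.mem_nhds a0,
      Metric.isClosed_closedBall.isOpen_compl.mem_nhds a1, Metric.isOpen_ball.mem_nhds aR]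
      with ξ b0 b1 bR
    exact ⟨Metric.ball_subset_closedBall bR, fun h => h.elim
      (fun h => b0 (Metric.ball_subset_closedBall h))
      (fun h => b1 (Metric.ball_subset_closedBall h))⟩
  have hζ₁K : ζ₁ ∈ K := mem_of_mem_nhds (hKnhds ζ₁ hζ₁0 hζ₁1
    (le_trans (EReal.coe_le_coe_iff.2 (by linarith)) hm))
  -- The perturbation costs at most 1 on `K`, exactly the margin in `m - 1`; hence the maximum point
  -- is interior.
  set ε := 1 / (R ^ 2 + 1) with hε
  have hε0 : 0 < ε := by positivity
  have hεK : ∀ ζ ∈ K, ε * ‖ζ‖ ^ 2 ≤ 1 := fun ζ hζ => by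
    have h2 : ‖ζ‖ ≤ R := by simpa using hζ.1
    rw [hε, one_div, inv_mul_le_iff₀ (by positivity)]
    nlinarith [norm_nonneg ζ]
  set ψ : ℂ → ℝ := fun ζ => ε * ‖ζ‖ ^ 2 - ℓ ζ with hψ
  have hψcont : ContinuousOn ψ K := by
    refine ContinuousOn.sub (by fun_prop) (ContinuousOn.const_mul (ContinuousOn.add ?_ ?_) s)
    · exact continuous_norm.continuousOn.log fun ζ hζ => norm_ne_zero_iff.2 (hK0 ζ hζ)
    · exact ContinuousOn.log (by fun_prop)
        fun ζ hζ => norm_ne_zero_iff.2 (sub_ne_zero.2 (hK1 ζ hζ))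
  have hgusc : UpperSemicontinuousOn g K := by
    have hcont : Continuous (fun ζ : ℂ => p + ζ • b) := by fun_prop
    have huu : UpperSemicontinuous u := upperSemicontinuousOn_univ_iff.1 hu.usc
    exact (huu.comp hcont).upperSemicontinuousOn K
  have husc : UpperSemicontinuousOn (fun ζ => g ζ + (ψ ζ : ℝ)) K :=
    hgusc.add' (continuous_coe_real_ereal.comp_continuousOn hψcont).upperSemicontinuousOn
      fun ζ _ => EReal.continuousAt_add (.inr (EReal.coe_ne_bot _)) (.inr (EReal.coe_ne_top _))
  obtain ⟨ζ₀, hζ₀, hmax⟩ := husc.exists_isMaxOn ⟨ζ₁, hζ₁K⟩ hKc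
  have hmax' : ∀ ζ ∈ K, g ζ + (ψ ζ : ℝ) ≤ g ζ₀ + (ψ ζ₀ : ℝ) := hmax
  have hge : (m : EReal) ≤ g ζ₀ + (ψ ζ₀ : ℝ) := by
    refine le_trans ?_ (hmax' ζ₁ hζ₁K)
    refine le_trans ?_ (add_le_add_left hm _)
    rw [← EReal.coe_add, EReal.coe_le_coe_iff, hψ]
    have : 0 ≤ ε * ‖ζ₁‖ ^ 2 := by positivity
    simp only
    linarith
  have hbot : g ζ₀ ≠ ⊥ := fun h => by
    rw [h, EReal.bot_add] at hge
    exact (EReal.bot_lt_coe m).not_ge hge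
  obtain ⟨g₀, hg₀⟩ : ∃ x : ℝ, g ζ₀ = x :=
    ⟨_, (EReal.coe_toReal (hu.lt_top _ (Set.mem_univ _)).ne hbot).symm⟩
  have hnhds : K ∈ 𝓝 ζ₀ := by
    refine hKnhds ζ₀ (hK0 _ hζ₀) (hK1 _ hζ₀) ?_
    rw [hg₀, ← EReal.coe_add, EReal.coe_le_coe_iff, hψ] at hge
    rw [hg₀, EReal.coe_le_coe_iff]
    have := hεK ζ₀ hζ₀
    simp only at hge
    linarith
  obtain ⟨H₀, hH₀an, hH₀0, hH₀⟩ := exists_analytic_re_eq_log_norm (hK0 _ hζ₀)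
  obtain ⟨H₁, hH₁an, hH₁0, hH₁⟩ := exists_analytic_re_eq_log_norm (sub_ne_zero.2 (hK1 _ hζ₀))
  have hnear : ∀ᶠ ζ : ℂ in 𝓝 0, ζ₀ + ζ ∈ K := by
    have : Continuous (fun ζ : ℂ => ζ₀ + ζ) := by fun_prop
    exact this.continuousAt.eventually (by simpa using hnhds)
  refine not_submean_of_le_re_sub_sq (g := fun ζ => g (ζ₀ + ζ))
    (H := fun ζ => ((g₀ + ψ ζ₀ - ε * ‖ζ₀‖ ^ 2 : ℝ) : ℂ) + (s : ℝ) * (H₀ ζ + H₁ ζ) -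
      (2 * ε : ℝ) * (ζ * starRingEnd ℂ ζ₀)) (ε := ε) (C := 0) hε0 ?_ ?_ ?_ ?_
  · exact (analyticAt_const.add (analyticAt_const.mul (hH₀an.add hH₁an))).sub (by fun_prop)
  · simp only [add_zero, zero_mul, mul_zero, sub_zero, Complex.add_re, Complex.re_ofReal_mul,
      Complex.ofReal_re, hH₀0, hH₁0, hψ, hℓ, hg₀]
    congr 1
    ring
  · filter_upwards [hH₀, hH₁, hnear] with ζ e0 e1 e2
    have e3 := hmax' _ e2
    rw [hg₀, ← EReal.coe_add] at e3
    have e4 := EReal.le_sub_iff_add_le (.inl (EReal.coe_ne_bot (ψ (ζ₀ + ζ))))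
      (.inl (EReal.coe_ne_top _)) |>.2 e3
    refine e4.trans ?_
    rw [← EReal.coe_sub, EReal.coe_le_coe_iff, hψ, hℓ]
    have e5 : ‖ζ₀ + ζ‖ ^ 2 = ‖ζ₀‖ ^ 2 + 2 * (ζ * starRingEnd ℂ ζ₀).re + ‖ζ‖ ^ 2 := by
      rw [← Complex.normSq_eq_norm_sq, ← Complex.normSq_eq_norm_sq, ← Complex.normSq_eq_norm_sq,
        add_comm ζ₀ ζ, Complex.normSq_add]
      ring
    simp only [e5, Complex.sub_re, Complex.add_re, Complex.ofReal_re, Complex.re_ofReal_mul, e0, e1,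
      add_sub_right_comm]
    linarith
  · have := hu.eventually_le_circleMean isOpen_univ (Set.mem_univ (p + ζ₀ • b)) b
    filter_upwards [this] with r hr
    simpa [hg, add_smul, add_assoc] using hr

/-! ### Quadratic maps with prescribed zeros -/

theorem exists_functional_eq {ι : Type*} {v : ι → Cn n} (hv : LinearIndependent ℂ v) (c : ι → ℂ) :
    ∃ f : Cn n →L[ℂ] ℂ, ∀ i, f (v i) = c i := by
  obtain ⟨f, hf⟩ := ((Module.Basis.span hv).constr ℂ c).exists_extend
  refine ⟨LinearMap.toContinuousLinearMap f, fun i => ?_⟩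
  have h1 := LinearMap.congr_fun hf (Module.Basis.span hv i)
  rw [Module.Basis.constr_basis] at h1
  rw [← h1]
  simp [Module.Basis.span_apply]

set_option synthInstance.maxHeartbeats 200000 in
/-- The set of points `p + a e₁ + b e₂ + a b k`, where `(a, b)` runs over the common zeros of the
line pairs `a (a + s b - 1)` and `b (t a + b - 1)`, is the zero set of a quadratic map with
nondegenerate zeros. -/
theorem gammaInv_le_two_of_linePairs {S : Set (Cn n)} {p e₁ e₂ k : Cn n} {x y : Cn n →L[ℂ] ℂ}
    {s t : ℂ} (hx₁ : x e₁ = 1) (hx₂ : x e₂ = 0) (hxk : x k = 0) (hy₁ : y e₁ = 0) (hy₂ : y e₂ = 1)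
    (hyk : y k = 0) (hs : s ≠ 1) (ht : t ≠ 1)
    (hS : ∀ z, z ∈ S ↔ ∃ a b : ℂ, a * (a + s * b - 1) = 0 ∧ b * (t * a + b - 1) = 0 ∧
      z = p + (a • e₁ + b • e₂ + (a * b) • k)) : gammaInv S ≤ 2 := by
  set L : Cn n →L[ℂ] Cn n :=
    ContinuousLinearMap.id ℂ (Cn n) - (2 : ℂ) • x.smulRight e₁ - (2 : ℂ) • y.smulRight e₂ with hL
  set B : Cn n →L[ℂ] Cn n →L[ℂ] Cn n :=
    x.smulRight ((x + s • y).smulRight e₁) + y.smulRight ((t • x + y).smulRight e₂) -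
      x.smulRight (y.smulRight k) with hB
  have hLv : ∀ v, L v = v - (2 * x v) • e₁ - (2 * y v) • e₂ := fun v => by
    simp [hL, smul_smul]
  have hBv : ∀ v w, B v w = (x v * (x w + s * y w)) • e₁ + (y v * (t * x w + y w)) • e₂ -
      (x v * y w) • k := fun v w => by
    simp [hB, smul_smul]
  have hzero : ∀ h, quadMap p L B (p + h) = 0 ↔ x h * (x h + s * y h - 1) = 0 ∧
      y h * (t * x h + y h - 1) = 0 ∧ h = x h • e₁ + y h • e₂ + (x h * y h) • k := by
    intro h
    -- The last bracket lies in the common kernel of `x` and `y`, so these functionals isolate the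
    -- two line-pair equations.
    have hF : quadMap p L B (p + h) = (x h * (x h + s * y h - 1)) • e₁ +
        (y h * (t * x h + y h - 1)) • e₂ + (h - (x h • e₁ + y h • e₂ + (x h * y h) • k)) := by
      rw [quadMap, add_sub_cancel_left, hLv, hBv]
      module
    rw [hF]
    constructor
    · intro h0
      have h1 := congrArg x h0
      have h2 := congrArg y h0
      simp only [map_add, map_sub, map_smul, hx₁, hx₂, hxk, hy₁, hy₂, hyk, map_zero,
        smul_eq_mul] at h1 h2
      have h1' : x h * (x h + s * y h - 1) = 0 := by linear_combination h1
      have h2' : y h * (t * x h + y h - 1) = 0 := by linear_combination h2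
      rw [h1', h2', zero_smul, zero_smul, add_zero, zero_add, sub_eq_zero] at h0
      exact ⟨h1', h2', h0⟩
    · rintro ⟨h1, h2, h3⟩
      rw [h1, h2, zero_smul, zero_smul, add_zero, zero_add, sub_eq_zero]
      exact h3
  have hSz : ∀ z, quadMap p L B z = 0 ↔ z ∈ S := by
    intro z
    obtain ⟨h, rfl⟩ : ∃ h, z = p + h := ⟨z - p, by abel⟩
    rw [hzero, hS]
    constructor
    · rintro ⟨h1, h2, h3⟩
      exact ⟨x h, y h, h1, h2, by rw [← h3]⟩
    · rintro ⟨a, b, h1, h2, h3⟩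
      have h4 := add_left_cancel h3
      have hxa : x h = a := by simp [h4, hx₁, hx₂, hxk]
      have hyb : y h = b := by simp [h4, hy₁, hy₂, hyk]
      rw [hxa, hyb]
      exact ⟨h1, h2, h4⟩
  refine gammaInv_le_two_of_quadMap hSz fun q hq v hv => ?_
  obtain ⟨h, rfl⟩ : ∃ h, q = p + h := ⟨q - p, by abel⟩
  obtain ⟨h1, h2, -⟩ := (hzero h).1 ((hSz _).2 hq)
  have hD : quadDeriv p L B (p + h) v = L v + B h v + B v h := by
    simp [quadDeriv]
  rw [hD, hLv, hBv, hBv] at hv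
  have hX := congrArg x hv
  have hY := congrArg y hv
  simp only [map_add, map_sub, map_smul, hx₁, hx₂, hxk, hy₁, hy₂, hyk, map_zero,
    smul_eq_mul] at hX hY
  generalize x h = a at *
  generalize y h = b at *
  have hX' : x v * (a + s * b - 1) + a * (x v + s * y v) = 0 := by linear_combination hX
  have hY' : y v * (t * a + b - 1) + b * (t * x v + y v) = 0 := by linear_combination hY
  have hXY : x v = 0 ∧ y v = 0 := by
    generalize x v = X at *
    generalize y v = Y at *
    rcases eq_or_ne a 0 with rfl | ha
    · rcases eq_or_ne b 0 with rfl | hb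
      · exact ⟨by linear_combination -hX', by linear_combination -hY'⟩
      · have hb1 : b = 1 := by
          have := (mul_eq_zero.1 h2).resolve_left hb
          linear_combination this
        subst hb1
        have h3 : X * (s - 1) = 0 := by linear_combination hX'
        have hX0 := (mul_eq_zero.1 h3).resolve_right (sub_ne_zero.2 hs)
        subst hX0
        exact ⟨rfl, by linear_combination hY'⟩
    · have ha1 := (mul_eq_zero.1 h1).resolve_left ha
      rcases eq_or_ne b 0 with rfl | hb
      · have ha2 : a = 1 := by linear_combination ha1
        subst ha2
        have h3 : Y * (t - 1) = 0 := by linear_combination hY'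
        have hY0 := (mul_eq_zero.1 h3).resolve_right (sub_ne_zero.2 ht)
        subst hY0
        exact ⟨by linear_combination hX', rfl⟩
      · have hb1 := (mul_eq_zero.1 h2).resolve_left hb
        have h3 : a * (X + s * Y) = 0 := by linear_combination hX' - X * ha1
        have h4 : b * (t * X + Y) = 0 := by linear_combination hY' - Y * hb1
        have h5 := (mul_eq_zero.1 h3).resolve_left ha
        have h6 := (mul_eq_zero.1 h4).resolve_left hb
        -- If `s t = 1`, eliminating `a` from the two line equations would force `t = 1`.
        have hst : 1 - s * t ≠ 0 := fun hst => ht (by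
          have h7 : b * (1 - s * t) = 1 - t := by linear_combination hb1 - t * ha1
          rw [hst, mul_zero] at h7
          linear_combination h7)
        have hX0 : X * (1 - s * t) = 0 := by linear_combination h5 - s * h6
        have hX1 := (mul_eq_zero.1 hX0).resolve_right hst
        subst hX1
        exact ⟨rfl, by linear_combination h6⟩
  rw [hXY.1, hXY.2] at hv
  simpa using hv

/-- With `s = t = -1` the lines `a - b = 1` and `b - a = 1` are parallel, so the fourth intersection
point disappears. -/
theorem gammaInv_triple_le_two {p e₁ e₂ : Cn n} (hind : LinearIndependent ℂ ![e₁, e₂]) :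
    gammaInv {p, p + e₁, p + e₂} ≤ 2 := by
  obtain ⟨x, hx⟩ := exists_functional_eq hind ![1, 0]
  obtain ⟨y, hy⟩ := exists_functional_eq hind ![0, 1]
  refine gammaInv_le_two_of_linePairs (p := p) (k := 0) (s := -1) (t := -1) (hx 0) (hx 1)
    (map_zero x) (hy 0) (hy 1) (map_zero y) (by norm_num) (by norm_num) fun z => ?_
  simp only [Set.mem_insert_iff, Set.mem_singleton_iff]
  constructor
  · rintro (rfl | rfl | rfl)
    · exact ⟨0, 0, by simp⟩
    · exact ⟨1, 0, by simp⟩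
    · exact ⟨0, 1, by simp⟩
  · rintro ⟨a, b, h1, h2, rfl⟩
    rcases mul_eq_zero.1 h1 with rfl | ha
    · rcases mul_eq_zero.1 h2 with rfl | hb
      · simp
      · obtain rfl : b = 1 := by linear_combination hb
        simp
    · rcases mul_eq_zero.1 h2 with rfl | hb
      · obtain rfl : a = 1 := by linear_combination ha
        simp
      · have : (2 : ℂ) = 0 := by linear_combination -ha - hb
        norm_num at this

theorem gammaInv_quadruple_le_two {p e₁ e₂ k : Cn n} {x y : Cn n →L[ℂ] ℂ} {s t a₀ b₀ : ℂ}
    (hx₁ : x e₁ = 1) (hx₂ : x e₂ = 0) (hxk : x k = 0) (hy₁ : y e₁ = 0) (hy₂ : y e₂ = 1)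
    (hyk : y k = 0) (hs : s ≠ 1) (ht : t ≠ 1) (hsab : a₀ + s * b₀ = 1) (htab : t * a₀ + b₀ = 1) :
    gammaInv {p, p + e₁, p + e₂, p + (a₀ • e₁ + b₀ • e₂ + (a₀ * b₀) • k)} ≤ 2 := by
  refine gammaInv_le_two_of_linePairs (p := p) hx₁ hx₂ hxk hy₁ hy₂ hyk hs ht fun z => ?_
  simp only [Set.mem_insert_iff, Set.mem_singleton_iff]
  constructor
  · rintro (rfl | rfl | rfl | rfl)
    · exact ⟨0, 0, by simp⟩
    · exact ⟨1, 0, by simp⟩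
    · exact ⟨0, 1, by simp⟩
    · exact ⟨a₀, b₀, by simp [hsab], by simp [htab], rfl⟩
  · rintro ⟨a, b, h1, h2, rfl⟩
    rcases mul_eq_zero.1 h1 with rfl | ha
    · rcases mul_eq_zero.1 h2 with rfl | hb
      · simp
      · obtain rfl : b = 1 := by linear_combination hb
        simp
    · rcases mul_eq_zero.1 h2 with rfl | hb
      · obtain rfl : a = 1 := by linear_combination ha
        simp
      · have hst : 1 - s * t ≠ 0 := fun hst => ht (by
          linear_combination htab - t * hsab - b₀ * hst)
        have h3 : (a - a₀) * (1 - s * t) = 0 := by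
          linear_combination ha - s * hb - hsab + s * htab
        have h4 : (b - b₀) * (1 - s * t) = 0 := by
          linear_combination hb - t * ha - htab + t * hsab
        obtain rfl := sub_eq_zero.1 ((mul_eq_zero.1 h3).resolve_right hst)
        obtain rfl := sub_eq_zero.1 ((mul_eq_zero.1 h4).resolve_right hst)
        simp

/-! ### Configurations with no three collinear points -/

theorem ne_add_smul_of_m₁_eq_two {S : Set (Cn n)} (hm : m₁ S = 2) {p q r : Cn n} (hp : p ∈ S)
    (hq : q ∈ S) (hr : r ∈ S) (hpq : p ≠ q) (hpr : p ≠ r) (hqr : q ≠ r) (c : ℂ) :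
    r ≠ p + c • (q - p) := by
  intro h
  have hfin : Module.finrank ℂ (line[ℂ, p, q]).direction = 1 := by
    rw [direction_affineSpan, vectorSpan_pair_rev]
    exact finrank_span_singleton (sub_ne_zero.2 hpq.symm)
  have hle : (S ∩ (line[ℂ, p, q] : Set (Cn n))).encard ≤ m₁ S :=
    le_iSup₂_of_le (line[ℂ, p, q]) hfin le_rfl
  have hrL : r ∈ line[ℂ, p, q] := by
    have h1 := AffineMap.lineMap_mem_affineSpan_pair (k := ℂ) c p q
    rwa [AffineMap.lineMap_apply, vsub_eq_sub, vadd_eq_add, add_comm, ← h] at h1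
  have hsub : ({p, q, r} : Set (Cn n)) ⊆ S ∩ (line[ℂ, p, q] : Set (Cn n)) := by
    rintro z (rfl | rfl | rfl)
    · exact ⟨hp, left_mem_affineSpan_pair ℂ _ _⟩
    · exact ⟨hq, right_mem_affineSpan_pair ℂ _ _⟩
    · exact ⟨hr, hrL⟩
  have h3 : ({p, q, r} : Set (Cn n)).encard = 3 :=
    Set.encard_eq_three.2 ⟨p, q, r, hpq, hpr, hqr, rfl⟩
  have h4 := (Set.encard_le_encard hsub).trans hle
  rw [h3, hm] at h4
  exact absurd h4 (by decide)

theorem gammaInv_le_two {S : Set (Cn n)} (hcard : S.encard = 3 ∨ S.encard = 4) (hm : m₁ S = 2) :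
    gammaInv S ≤ 2 := by
  have hind : ∀ {p q r : Cn n}, p ∈ S → q ∈ S → r ∈ S → p ≠ q → p ≠ r → q ≠ r →
      LinearIndependent ℂ ![q - p, r - p] := fun hp hq hr hpq hpr hqr =>
    (LinearIndependent.pair_iff' (sub_ne_zero.2 hpq.symm)).2 fun c hc =>
      ne_add_smul_of_m₁_eq_two hm hp hq hr hpq hpr hqr c (by rw [hc]; abel)
  rcases hcard with h | h
  · obtain ⟨p, q, r, hpq, hpr, hqr, rfl⟩ := Set.encard_eq_three.1 h
    have := gammaInv_triple_le_two (p := p) (hind (by simp) (by simp) (by simp) hpq hpr hqr)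
    simpa using this
  · obtain ⟨w, hw⟩ : S.Nonempty := by
      rw [← Set.encard_ne_zero, h]
      decide
    have hdiff : (S \ {w}).encard = 3 := by
      have h1 := Set.encard_sdiff_singleton_add_one hw
      rw [h] at h1
      exact ENat.add_left_injective_of_ne_top ENat.one_ne_top (h1.trans (by norm_num))
    obtain ⟨p, q, r, hpq, hpr, hqr, hS⟩ := Set.encard_eq_three.1 hdiff
    have hp : p ∈ S \ {w} := by simp [hS]
    have hq : q ∈ S \ {w} := by simp [hS]
    have hr : r ∈ S \ {w} := by simp [hS]
    have hSeq : S = {p, q, r, w} := by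
      rw [← Set.insert_sdiff_self_of_mem hw, hS]
      ext z
      simp only [Set.mem_insert_iff, Set.mem_singleton_iff]
      tauto
    have hpair := hind hp.1 hq.1 hr.1 hpq hpr hqr
    by_cases hspan : w - p ∈ Submodule.span ℂ {q - p, r - p}
    · obtain ⟨a, b, hab⟩ := Submodule.mem_span_pair.1 hspan
      have hw' : w = p + (a • (q - p) + b • (r - p)) := by rw [hab]; abel
      have ha : a ≠ 0 := by
        rintro rfl
        exact ne_add_smul_of_m₁_eq_two hm hp.1 hr.1 hw hpr hp.2 hr.2 b (by simpa using hw')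
      have hb : b ≠ 0 := by
        rintro rfl
        exact ne_add_smul_of_m₁_eq_two hm hp.1 hq.1 hw hpq hp.2 hq.2 a (by simpa using hw')
      have hab1 : a + b ≠ 1 := fun h1 =>
        ne_add_smul_of_m₁_eq_two hm hq.1 hr.1 hw hqr hq.2 hr.2 b (by
          rw [hw', eq_sub_of_add_eq h1]
          module)
      obtain ⟨x, hx⟩ := exists_functional_eq hpair ![1, 0]
      obtain ⟨y, hy⟩ := exists_functional_eq hpair ![0, 1]
      -- These slopes send one line through `(1, 0)` and `(a, b)`, the other through `(0, 1)` and
      -- `(a, b)`; both differ from 1 because `a + b ≠ 1`.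
      have key := gammaInv_quadruple_le_two (p := p) (k := 0) (s := (1 - a) / b) (t := (1 - b) / a)
        (e₁ := q - p) (e₂ := r - p) (a₀ := a) (b₀ := b) (hx 0) (hx 1) (map_zero x) (hy 0) (hy 1) (map_zero y)
        (fun h1 => hab1 (by
          rw [div_eq_one_iff_eq hb] at h1
          linear_combination -h1))
        (fun h1 => hab1 (by
          rw [div_eq_one_iff_eq ha] at h1
          linear_combination -h1))
        (by field_simp; ring) (by field_simp; ring)
      rw [smul_zero, add_zero, ← hw', add_sub_cancel, add_sub_cancel, ← hSeq] at key
      exact key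
    · have htriple : LinearIndependent ℂ ![w - p, q - p, r - p] :=
        linearIndependent_finCons.2 ⟨hpair, by simpa [Set.pair_comm] using hspan⟩
      -- The coordinates place `w` over `(1, 1)`, completing a square cut out by `a (a - 1)` and `b
      -- (b - 1)`; `k` lifts that corner to `w`.
      obtain ⟨x, hx⟩ := exists_functional_eq htriple ![1, 1, 0]
      obtain ⟨y, hy⟩ := exists_functional_eq htriple ![1, 0, 1]
      have hx0 : x (w - p) = 1 := hx 0
      have hx1 : x (q - p) = 1 := hx 1
      have hx2 : x (r - p) = 0 := hx 2
      have hy0 : y (w - p) = 1 := hy 0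
      have hy1 : y (q - p) = 0 := hy 1
      have hy2 : y (r - p) = 1 := hy 2
      have key := gammaInv_quadruple_le_two (p := p) (k := w - p - (q - p) - (r - p)) (s := 0)
        (t := 0) (a₀ := 1) (b₀ := 1) hx1 hx2 (by rw [map_sub, map_sub, hx0, hx1, hx2]; ring)
        hy1 hy2 (by rw [map_sub, map_sub, hy0, hy1, hy2]; ring) zero_ne_one zero_ne_one
        (by ring) (by ring)
      have hw' : p + ((1 : ℂ) • (q - p) + (1 : ℂ) • (r - p) +
          ((1 : ℂ) * 1) • (w - p - (q - p) - (r - p))) = w := by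
        module
      rw [hw', add_sub_cancel, add_sub_cancel, ← hSeq] at key
      exact key

end PluriGreen

theorem lemma2p2 (n : ℕ) (S : Set (PluriGreen.Cn n))
    (hcard : S.encard = 3 ∨ S.encard = 4) (hm : PluriGreen.m₁ S = 2) :
    PluriGreen.gammaInv S = 2 := by
  refine le_antisymm (PluriGreen.gammaInv_le_two hcard hm) (le_iInf₂ fun u hu => ?_)
  have hone : 1 < S.encard := by
    rcases hcard with h | h <;> rw [h] <;> decide
  obtain ⟨p, q, hp, hq, hpq⟩ := Set.one_lt_encard_iff.1 hone
  exact PluriGreen.two_le_growth hu.1.psh hpq (hu.2 p hp) (hu.2 q hq)
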